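/- Let $\ell\ge 0$ be an integer and, for $u,z\in\mathbb{R}^\ell_{++}$ (vectors with positive coordinates), let $f(u,z)=\sum_{i=1}^{\ell}u_i\ln(u_i/z_i)$ be the vector relative entropy. Let $\operatorname{epi} f=\{(t,u,z)\in\mathbb{R}\times\mathbb{R}^\ell_{++}\times\mathbb{R}^\ell_{++} : f(u,z)\le t\}$ and let $G$ be the closure of $\operatorname{epi} f$ in $\mathbb{R}\times\mathbb{R}^\ell\times\mathbb{R}^\ell$. Then the interior of $G$ is $\{(t,u,z) : u,z\in\mathbb{R}^\ell_{++},\ f(u,z)<t\}$, and the function $$\Phi(t,u,z)=-\ln\Bigl(t-\sum_{i=1}^{\ell}u_i\ln(u_i/z_i)\Bigr)-\sum_{i=1}^{\ell}\ln z_i-\sum_{i=1}^{\ell}\ln u_i$$ is a $(2\ell+1)$-logarithmically homogeneous self-concordant barrier for $G$. That is, with $\vartheta=2\ell+1$: $G$ is a closed convex cone with nonempty interior; $\Phi$ is convex and three times continuously differentiable on $\operatorname{int}G$; the sets $\{x\in\operatorname{int}G:\Phi(x)\le c\}$, $c\in\mathbb{R}$, are closed in $\mathbb{R}\times\mathbb{R}^\ell\times\mathbb{R}^\ell$;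 and for all $x\in\operatorname{int}G$, all directions $h$ and all $s>0$, $$|D^3\Phi(x)[h,h,h]|\le 2\,(D^2\Phi(x)[h,h])^{3/2},\qquad (D\Phi(x)[h])^2\le\vartheta\,D^2\Phi(x)[h,h],\qquad \Phi(sx)=\Phi(x)-\vartheta\ln s .$$ Moreover, the map $A(u,z)=-\sum_{i=1}^{\ell}u_i\ln(u_i/z_i)$ is $(\mathbb{R}_+,1)$-compatible with the barrier $F(u,z)=-\sum_{i=1}^{\ell}\ln u_i-\sum_{i=1}^{\ell}\ln z_i$ of $\mathbb{R}^\ell_+\times\mathbb{R}^\ell_+$. That is, $F$ is a $\vartheta'$-self-concordant barrier for $\mathbb{R}^\ell_+\times\mathbb{R}^\ell_+$ for some $\vartheta'\ge 0$ (in the above sense, without the cone condition and the last identity), $A$ is three times continuously differentiable and concave on $\mathbb{R}^\ell_{++}\times\mathbb{R}^\ell_{++}$, and for all $x\in\mathbb{R}^\ell_{++}\times\mathbb{R}^\ell_{++}$ and all $h\in\mathbb{R}^\ell\times\mathbb{R}^\ell$, $$D^3A(x)[h,h,h]\le -3\,D^2A(x)[h,h]\,\sqrt{D^2F(x)[h,h]}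 .$$ -/

import Mathlib

/-- `SecondDeriv F x h` is the second directional differential `D²F(x)[h,h]`. -/
noncomputable def SecondDeriv {E V : Type*} [NormedAddCommGroup E] [NormedSpace ℝ E]
    [NormedAddCommGroup V] [NormedSpace ℝ V] (F : E → V) (x h : E) : V :=
  iteratedFDeriv ℝ 2 F x (fun _ => h)

/-- `ThirdDeriv F x h` is the third directional differential `D³F(x)[h,h,h]`. -/
noncomputable def ThirdDeriv {E V : Type*} [NormedAddCommGroup E] [NormedSpace ℝ E]
    [NormedAddCommGroup V] [NormedSpace ℝ V] (F : E → V) (x h : E) : V :=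
  iteratedFDeriv ℝ 3 F x (fun _ => h)

/-- `F` is (strongly, standard) self-concordant on the nonempty open convex set `Q`: it is convex
and three times continuously differentiable on `Q`, satisfies
`|D³F(x)[h,h,h]| ≤ 2 (D²F(x)[h,h])^{3/2}`, and its sublevel sets are closed in the whole space.
Only the values of `F` on `Q` matter. -/
structure IsSelfConcordantOn {E : Type*} [NormedAddCommGroup E] [NormedSpace ℝ E]
    (Q : Set E) (F : E → ℝ) : Prop where
  nonempty : Q.Nonempty
  isOpen : IsOpen Q
  convexOn : ConvexOn ℝ Q F
  contDiffOn : ContDiffOn ℝ 3 F Q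
  third_le : ∀ x ∈ Q, ∀ h : E, |ThirdDeriv F x h| ≤ 2 * (SecondDeriv F x h) ^ (3 / 2 : ℝ)
  isClosed_sublevel : ∀ c : ℝ, IsClosed {x | x ∈ Q ∧ F x ≤ c}

/-- `F` is a `ϑ`-self-concordant barrier for the closed convex set `G` (with nonempty interior):
it is self-concordant on the interior of `G` and its Newton decrement is at most `√ϑ` there, that
is, `(DF(x)[h])² ≤ ϑ D²F(x)[h,h]`. -/
structure IsSelfConcordantBarrier {E : Type*} [NormedAddCommGroup E] [NormedSpace ℝ E]
    (ϑ : ℝ) (G : Set E) (F : E → ℝ) : Prop where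
  parameter_nonneg : 0 ≤ ϑ
  isClosed : IsClosed G
  convex : Convex ℝ G
  selfConcordant : IsSelfConcordantOn (interior G) F
  decrement_le : ∀ x ∈ interior G, ∀ h : E, (fderiv ℝ F x h) ^ 2 ≤ ϑ * SecondDeriv F x h

/-- `F` is a `ϑ`-logarithmically homogeneous self-concordant barrier for `G`: the set `G` is a
closed convex cone with nonempty interior, `F` is a `ϑ`-self-concordant barrier for it, and
`F (s x) = F x - ϑ ln s` for all `x` in the interior of `G` and all `s > 0`. -/
structure IsLHSelfConcordantBarrier {E : Type*} [NormedAddCommGroup E] [NormedSpace ℝ E]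
    (ϑ : ℝ) (G : Set E) (F : E → ℝ) : Prop where
  cone : ∀ x ∈ G, ∀ s : ℝ, 0 < s → s • x ∈ G
  barrier : IsSelfConcordantBarrier ϑ G F
  logHomogeneous : ∀ x ∈ interior G, ∀ s : ℝ, 0 < s → F (s • x) = F x - ϑ * Real.log s

/-- Let `K` be a closed convex cone in `V` and `F` a self-concordant barrier for `G`. The map
`A : int G → V` is `(K, β)`-compatible with `F` if it is three times continuously differentiable
and concave with respect to `K` on `int G`, and
`D³A(x)[h,h,h] ≤_K -3 β √(D²F(x)[h,h]) D²A(x)[h,h]`, where `v ≤_K w` means `w - v ∈ K`. -/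
structure IsCompatible {E V : Type*} [NormedAddCommGroup E] [NormedSpace ℝ E]
    [NormedAddCommGroup V] [NormedSpace ℝ V]
    (K : ProperCone ℝ V) (β : ℝ) (G : Set E) (F : E → ℝ) (A : E → V) : Prop where
  parameter_nonneg : 0 ≤ β
  barrier : ∃ ϑ : ℝ, IsSelfConcordantBarrier ϑ G F
  contDiffOn : ContDiffOn ℝ 3 A (interior G)
  concave : ∀ x ∈ interior G, ∀ y ∈ interior G, ∀ a b : ℝ, 0 ≤ a → 0 ≤ b → a + b = 1 →
    A (a • x + b • y) - (a • A x + b • A y) ∈ K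
  third_le : ∀ x ∈ interior G, ∀ h : E,
    (-(3 * β * Real.sqrt (SecondDeriv F x h))) • SecondDeriv A x h - ThirdDeriv A x h ∈ K

/-- The vector relative entropy `∑ uᵢ ln (uᵢ / zᵢ)`; it is used for positive vectors only. -/
noncomputable def vecRelEntropy {ℓ : ℕ} (u z : Fin ℓ → ℝ) : ℝ :=
  ∑ i, u i * Real.log (u i / z i)

/-- The epigraph of the vector relative entropy, as a function on pairs of positive vectors;
a point is a triple `(t, u, z)`. -/
def vecRelEntropyEpigraph (ℓ : ℕ) : Set (ℝ × (Fin ℓ → ℝ) × (Fin ℓ → ℝ)) :=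
  {p | (∀ i, 0 < p.2.1 i) ∧ (∀ i, 0 < p.2.2 i) ∧ vecRelEntropy p.2.1 p.2.2 ≤ p.1}

/-- The function `Φ(t,u,z) = -ln (t - ∑ uᵢ ln (uᵢ/zᵢ)) - ∑ ln zᵢ - ∑ ln uᵢ`. -/
noncomputable def vecRelEntropyBarrier (ℓ : ℕ) (p : ℝ × (Fin ℓ → ℝ) × (Fin ℓ → ℝ)) : ℝ :=
  -Real.log (p.1 - ∑ i, p.2.1 i * Real.log (p.2.1 i / p.2.2 i))
    - ∑ i, Real.log (p.2.2 i) - ∑ i, Real.log (p.2.1 i)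

/-! Everything is computed along lines: on an open set the diagonal differentials of a `C³` function
are its successive line derivatives. For a direction h put aᵢ = hᵤᵢ/uᵢ, bᵢ = h_zᵢ/zᵢ, R = ∑ (aᵢ² +
bᵢ²) = D²F[h,h]. The entropy has second derivative ∑ wᵢ with wᵢ = uᵢ(aᵢ - bᵢ)² ≥ 0 and third
derivative -∑ wᵢ(aᵢ + 2bᵢ). Since |aᵢ + 2bᵢ| ≤ 3√R, compatibility with β = 1 follows
(`abs_sum_weight_mul_le`).

For Φ, let τ be the slack t - f(u,z), d = τ'/τ, σ = -τ''/τ ≥ 0, κ = τ'''/τ, so that |κ| ≤ 3√R σ.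
Then D²Φ = d² + σ + R and |D³Φ| ≤ w(3M² - w²) with w = |d| + √R and M² = D²Φ; the maximum over w ≥ 0
is 2M³ (`abs_third_le_of_abs_le`). The decrement bound is Cauchy–Schwarz over 2ℓ + 1 logarithms.

Sublevel sets need care, as the entropy is not continuous up to the boundary: exponentiating Φ ≤ c
and using f ≥ ∑ (uᵢ - zᵢ) confines them to a closed set on which all coordinates are positive. -/

open Filter Topology

/-- Along the direction `h`, the functions `D₁`, `D₂`, `D₃` are the first three successive line
derivatives of `F` on `Q`. -/
structure HasThreeLineDerivsOn {E : Type*} [NormedAddCommGroup E] [NormedSpace ℝ E]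
    (Q : Set E) (h : E) (F D₁ D₂ D₃ : E → ℝ) : Prop where
  first : ∀ x ∈ Q, HasLineDerivAt ℝ F (D₁ x) x h
  second : ∀ x ∈ Q, HasLineDerivAt ℝ D₁ (D₂ x) x h
  third : ∀ x ∈ Q, HasLineDerivAt ℝ D₂ (D₃ x) x h

/-! ### Calculus of line derivatives -/

section LineDerivs

variable {E : Type*} [NormedAddCommGroup E] [NormedSpace ℝ E]

/-- Evaluation at the constant tuple is continuous and linear, so it commutes with differentiation
along h; this is the induction step from order n to n + 1. -/
theorem iteratedFDeriv_succ_diag_eq_of_hasLineDerivAt {Q : Set E} (hQ : IsOpen Q) {F : E → ℝ}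
    {n : ℕ} {N : WithTop ℕ∞} (hN : n < N) (hF : ContDiffOn ℝ N F Q) {h : E} {D D' : E → ℝ}
    (hD : ∀ x ∈ Q, iteratedFDeriv ℝ n F x (fun _ => h) = D x)
    (hD' : ∀ x ∈ Q, HasLineDerivAt ℝ D (D' x) x h) {x : E} (hx : x ∈ Q) :
    iteratedFDeriv ℝ (n + 1) F x (fun _ => h) = D' x := by
  have hdiff : DifferentiableAt ℝ (iteratedFDeriv ℝ n F) x :=
    (hF.contDiffAt (hQ.mem_nhds hx)).differentiableAt_iteratedFDeriv hN
  have happ : HasFDerivAt (fun y => iteratedFDeriv ℝ n F y (fun _ => h))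
      ((ContinuousMultilinearMap.apply ℝ (fun _ : Fin n => E) ℝ (fun _ => h)).comp
        (fderiv ℝ (iteratedFDeriv ℝ n F) x)) x :=
    (ContinuousMultilinearMap.apply ℝ (fun _ : Fin n => E) ℝ (fun _ => h)).hasFDerivAt.comp x
      hdiff.hasFDerivAt
  have hline := (happ.hasLineDerivAt h).congr_of_eventuallyEq (f₁ := D)
    (Filter.eventually_of_mem (hQ.mem_nhds hx) fun y hy => (hD y hy).symm)
  rw [iteratedFDeriv_succ_apply_left]
  exact hline.unique (hD' x hx)

namespace HasThreeLineDerivsOn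

variable {Q : Set E} {h : E} {F D₁ D₂ D₃ G G₁ G₂ G₃ : E → ℝ}

theorem fderiv_apply_eq (hd : HasThreeLineDerivsOn Q h F D₁ D₂ D₃) (hQ : IsOpen Q)
    (hF : ContDiffOn ℝ 3 F Q) {x : E} (hx : x ∈ Q) : fderiv ℝ F x h = D₁ x :=
  (((hF.contDiffAt (hQ.mem_nhds hx)).differentiableAt
    (by norm_num)).hasFDerivAt.hasLineDerivAt h).unique (hd.first x hx)

theorem iteratedFDeriv_one_eq (hd : HasThreeLineDerivsOn Q h F D₁ D₂ D₃) (hQ : IsOpen Q)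
    (hF : ContDiffOn ℝ 3 F Q) : ∀ x ∈ Q, iteratedFDeriv ℝ 1 F x (fun _ => h) = D₁ x := by
  intro x hx
  rw [iteratedFDeriv_one_apply]
  exact hd.fderiv_apply_eq hQ hF hx

theorem secondDeriv_eq (hd : HasThreeLineDerivsOn Q h F D₁ D₂ D₃) (hQ : IsOpen Q)
    (hF : ContDiffOn ℝ 3 F Q) : ∀ x ∈ Q, SecondDeriv F x h = D₂ x := fun _ hx =>
  iteratedFDeriv_succ_diag_eq_of_hasLineDerivAt (n := 1) hQ (by norm_cast) hF
    (hd.iteratedFDeriv_one_eq hQ hF) hd.second hx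

theorem thirdDeriv_eq (hd : HasThreeLineDerivsOn Q h F D₁ D₂ D₃) (hQ : IsOpen Q)
    (hF : ContDiffOn ℝ 3 F Q) : ∀ x ∈ Q, ThirdDeriv F x h = D₃ x := fun _ hx =>
  iteratedFDeriv_succ_diag_eq_of_hasLineDerivAt (n := 2) hQ (by norm_cast) hF
    (hd.secondDeriv_eq hQ hF) hd.third hx

theorem add (hF : HasThreeLineDerivsOn Q h F D₁ D₂ D₃) (hG : HasThreeLineDerivsOn Q h G G₁ G₂ G₃) :
    HasThreeLineDerivsOn Q h (fun x => F x + G x) (fun x => D₁ x + G₁ x) (fun x => D₂ x + G₂ x)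
      (fun x => D₃ x + G₃ x) where
  first x hx := HasDerivAt.add (hF.first x hx) (hG.first x hx)
  second x hx := HasDerivAt.add (hF.second x hx) (hG.second x hx)
  third x hx := HasDerivAt.add (hF.third x hx) (hG.third x hx)

theorem neg (hF : HasThreeLineDerivsOn Q h F D₁ D₂ D₃) :
    HasThreeLineDerivsOn Q h (fun x => -F x) (fun x => -D₁ x) (fun x => -D₂ x)
      (fun x => -D₃ x) where
  first x hx := HasDerivAt.fun_neg (hF.first x hx)
  second x hx := HasDerivAt.fun_neg (hF.second x hx)
  third x hx := HasDerivAt.fun_neg (hF.third x hx)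

theorem sum {ι : Type*} (s : Finset ι) {F D₁ D₂ D₃ : ι → E → ℝ}
    (hF : ∀ i ∈ s, HasThreeLineDerivsOn Q h (F i) (D₁ i) (D₂ i) (D₃ i)) :
    HasThreeLineDerivsOn Q h (fun x => ∑ i ∈ s, F i x) (fun x => ∑ i ∈ s, D₁ i x)
      (fun x => ∑ i ∈ s, D₂ i x) (fun x => ∑ i ∈ s, D₃ i x) where
  first x hx := HasDerivAt.fun_sum fun i hi => (hF i hi).first x hx
  second x hx := HasDerivAt.fun_sum fun i hi => (hF i hi).second x hx
  third x hx := HasDerivAt.fun_sum fun i hi => (hF i hi).third x hx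

theorem comp_clm {E' : Type*} [NormedAddCommGroup E'] [NormedSpace ℝ E'] (L : E' →L[ℝ] E)
    {h' : E'} {Q' : Set E'} (hQ' : Set.MapsTo L Q' Q)
    (hF : HasThreeLineDerivsOn Q (L h') F D₁ D₂ D₃) :
    HasThreeLineDerivsOn Q' h' (fun x => F (L x)) (fun x => D₁ (L x)) (fun x => D₂ (L x))
      (fun x => D₃ (L x)) where
  first x hx := by simpa [HasLineDerivAt] using hF.first _ (hQ' hx)
  second x hx := by simpa [HasLineDerivAt] using hF.second _ (hQ' hx)
  third x hx := by simpa [HasLineDerivAt] using hF.third _ (hQ' hx)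

theorem clm (L : E →L[ℝ] ℝ) :
    HasThreeLineDerivsOn Q h (fun x => L x) (fun _ => L h) (fun _ => 0) (fun _ => 0) where
  first _ _ := L.hasFDerivAt.hasLineDerivAt h
  second _ _ := hasDerivAt_const _ _
  third _ _ := hasDerivAt_const _ _

theorem neg_log (hF : HasThreeLineDerivsOn Q h F D₁ D₂ D₃) (hpos : ∀ x ∈ Q, 0 < F x) :
    HasThreeLineDerivsOn Q h (fun x => -Real.log (F x)) (fun x => -(D₁ x / F x))
      (fun x => (D₁ x / F x) ^ 2 - D₂ x / F x)
      (fun x => -(D₃ x / F x) + 3 * (D₂ x / F x) * (D₁ x / F x) - 2 * (D₁ x / F x) ^ 3) where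
  first x hx := by
    have h0 : F (x + (0 : ℝ) • h) ≠ 0 := by simpa using (hpos x hx).ne'
    have := (HasDerivAt.log (hF.first x hx) h0).fun_neg
    simpa [HasLineDerivAt] using this
  second x hx := by
    have h0 : F (x + (0 : ℝ) • h) ≠ 0 := by simpa using (hpos x hx).ne'
    have := (HasDerivAt.fun_div (hF.second x hx) (hF.first x hx) h0).fun_neg
    simp only [zero_smul, add_zero] at this h0
    unfold HasLineDerivAt
    convert this using 1
    field_simp
    ring
  third x hx := by
    have h0 : F (x + (0 : ℝ) • h) ≠ 0 := by simpa using (hpos x hx).ne'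
    have := ((HasDerivAt.fun_div (hF.second x hx) (hF.first x hx) h0).fun_pow 2).fun_sub
      (HasDerivAt.fun_div (hF.third x hx) (hF.first x hx) h0)
    simp only [zero_smul, add_zero] at this h0
    unfold HasLineDerivAt
    rw [show 2 - 1 = 1 from rfl, pow_one, Nat.cast_ofNat] at this
    convert this using 1
    field_simp
    ring

end HasThreeLineDerivsOn

theorem HasLineDerivAt.hasDerivAt_line {F : E → ℝ} {d : ℝ} {x h : E} {s : ℝ}
    (hF : HasLineDerivAt ℝ F d (x + s • h) h) : HasDerivAt (fun r : ℝ => F (x + r • h)) d s := by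
  have h1 : HasDerivAt (fun t : ℝ => F (x + s • h + t • h)) d (s - s) := by
    simpa [HasLineDerivAt] using hF
  have h2 := h1.comp_sub_const s s
  refine h2.congr_of_eventuallyEq (Filter.Eventually.of_forall fun r => ?_)
  simp only [add_assoc, ← add_smul, add_sub_cancel]

/-- Convexity is tested on segments, where the one-variable second derivative criterion applies with
h = y - x. -/
theorem convexOn_of_hasLineDerivAt2_nonneg {Q : Set E} (hQ : Convex ℝ Q) {F : E → ℝ}
    {D₁ D₂ : E → E → ℝ} (h₁ : ∀ h, ∀ x ∈ Q, HasLineDerivAt ℝ F (D₁ h x) x h)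
    (h₂ : ∀ h, ∀ x ∈ Q, HasLineDerivAt ℝ (D₁ h) (D₂ h x) x h)
    (h₃ : ∀ h, ∀ x ∈ Q, 0 ≤ D₂ h x) : ConvexOn ℝ Q F := by
  refine ⟨hQ, fun x hx y hy a b ha hb hab => ?_⟩
  have hmem : ∀ s ∈ Set.Icc (0 : ℝ) 1, x + s • (y - x) ∈ Q := fun s hs =>
    hQ.add_smul_sub_mem hx hy hs
  have hder : ∀ s ∈ Set.Icc (0 : ℝ) 1, HasDerivAt (fun r : ℝ => F (x + r • (y - x)))
      (D₁ (y - x) (x + s • (y - x))) s := fun s hs => (h₁ _ _ (hmem s hs)).hasDerivAt_line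
  have hconv : ConvexOn ℝ (Set.Icc (0 : ℝ) 1) (fun r : ℝ => F (x + r • (y - x))) := by
    refine convexOn_of_hasDerivWithinAt2_nonneg (convex_Icc 0 1)
      (fun s hs => (hder s hs).continuousAt.continuousWithinAt)
      (fun s hs => (hder s (interior_subset hs)).hasDerivWithinAt)
      (fun s hs => (h₂ _ _ (hmem s (interior_subset hs))).hasDerivAt_line.hasDerivWithinAt)
      (fun s hs => h₃ _ _ (hmem s (interior_subset hs)))
  have := hconv.2 (x := 0) (by simp) (y := 1) (by simp) ha hb hab
  have e : x + b • (y - x) = a • x + b • y := by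
    rw [show a = 1 - b by linarith, smul_sub, sub_smul, one_smul]; abel
  simpa [e] using this

end LineDerivs

/-! ### Derivatives and inequalities on the positive orthants -/

/-- Pairs of vectors with positive coordinates. -/
def positivePairs (ℓ : ℕ) : Set ((Fin ℓ → ℝ) × (Fin ℓ → ℝ)) :=
  {p | (∀ i, 0 < p.1 i) ∧ (∀ i, 0 < p.2 i)}

section PositivePairs

variable {ℓ : ℕ}

theorem interior_nonnegPairs :
    interior {p : (Fin ℓ → ℝ) × (Fin ℓ → ℝ) | (∀ i, 0 ≤ p.1 i) ∧ (∀ i, 0 ≤ p.2 i)} =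
      positivePairs ℓ := by
  have h : {p : (Fin ℓ → ℝ) × (Fin ℓ → ℝ) | (∀ i, 0 ≤ p.1 i) ∧ (∀ i, 0 ≤ p.2 i)} =
      (Set.univ.pi fun _ => Set.Ici 0) ×ˢ (Set.univ.pi fun _ => Set.Ici 0) := by
    ext p; simp only [Set.mem_prod, Set.mem_univ_pi, Set.mem_Ici]; rfl
  rw [h, interior_prod_eq, interior_pi_set Set.finite_univ]
  ext p; simp [positivePairs]

theorem isOpen_positivePairs : IsOpen (positivePairs ℓ) :=
  interior_nonnegPairs (ℓ := ℓ) ▸ isOpen_interior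

theorem isClosed_nonnegPairs :
    IsClosed {p : (Fin ℓ → ℝ) × (Fin ℓ → ℝ) | (∀ i, 0 ≤ p.1 i) ∧ (∀ i, 0 ≤ p.2 i)} := by
  simp only [Set.ofPred_and, Set.ofPred_forall]
  exact (isClosed_iInter fun i => isClosed_le continuous_const (by fun_prop)).inter
    (isClosed_iInter fun i => isClosed_le continuous_const (by fun_prop))

theorem convex_nonnegPairs :
    Convex ℝ {p : (Fin ℓ → ℝ) × (Fin ℓ → ℝ) | (∀ i, 0 ≤ p.1 i) ∧ (∀ i, 0 ≤ p.2 i)} := by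
  rintro p ⟨hp, hp'⟩ q ⟨hq, hq'⟩ a b ha hb -
  exact ⟨fun i => add_nonneg (mul_nonneg ha (hp i)) (mul_nonneg hb (hq i)),
    fun i => add_nonneg (mul_nonneg ha (hp' i)) (mul_nonneg hb (hq' i))⟩

theorem convex_positivePairs : Convex ℝ (positivePairs ℓ) :=
  interior_nonnegPairs (ℓ := ℓ) ▸ convex_nonnegPairs.interior

theorem contDiffOn_entropy : ContDiffOn ℝ 3
    (fun p : (Fin ℓ → ℝ) × (Fin ℓ → ℝ) => ∑ i, p.1 i * Real.log (p.1 i / p.2 i))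
    (positivePairs ℓ) := by
  refine ContDiffOn.sum fun i _ => ?_
  refine ContDiffOn.mul (by fun_prop) (ContDiffOn.log (ContDiffOn.div (by fun_prop) (by fun_prop)
    fun p hp => (hp.2 i).ne') fun p hp => (div_pos (hp.1 i) (hp.2 i)).ne')

theorem contDiffOn_sum_neg_log : ContDiffOn ℝ 3
    (fun p : (Fin ℓ → ℝ) × (Fin ℓ → ℝ) => -∑ i, Real.log (p.1 i) - ∑ i, Real.log (p.2 i))
    (positivePairs ℓ) := by
  refine ContDiffOn.sub (ContDiffOn.neg (ContDiffOn.sum fun i _ => ?_))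
    (ContDiffOn.sum fun i _ => ?_)
  · exact ContDiffOn.log (by fun_prop) fun p hp => (hp.1 i).ne'
  · exact ContDiffOn.log (by fun_prop) fun p hp => (hp.2 i).ne'

theorem hasThreeLineDerivsOn_entropy (h : (Fin ℓ → ℝ) × (Fin ℓ → ℝ)) :
    HasThreeLineDerivsOn (positivePairs ℓ) h (fun p => ∑ i, p.1 i * Real.log (p.1 i / p.2 i))
      (fun p => ∑ i, (h.1 i * Real.log (p.1 i / p.2 i) + h.1 i - p.1 i * h.2 i / p.2 i))
      (fun p => ∑ i, p.1 i * (h.1 i / p.1 i - h.2 i / p.2 i) ^ 2)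
      (fun p => ∑ i, -(p.1 i * (h.1 i / p.1 i - h.2 i / p.2 i) ^ 2 *
        (h.1 i / p.1 i + 2 * (h.2 i / p.2 i)))) := by
  refine HasThreeLineDerivsOn.sum _ fun i _ => ?_
  have hu : ∀ p : (Fin ℓ → ℝ) × (Fin ℓ → ℝ),
      HasDerivAt (fun t : ℝ => (p + t • h).1 i) (h.1 i) 0 := fun p => by
    simpa using ((hasDerivAt_id (0 : ℝ)).mul_const (h.1 i)).const_add (p.1 i)
  have hz : ∀ p : (Fin ℓ → ℝ) × (Fin ℓ → ℝ),
      HasDerivAt (fun t : ℝ => (p + t • h).2 i) (h.2 i) 0 := fun p => by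
    simpa using ((hasDerivAt_id (0 : ℝ)).mul_const (h.2 i)).const_add (p.2 i)
  refine ⟨fun p hp => ?_, fun p hp => ?_, fun p hp => ?_⟩
  all_goals
    have hu0 := (hp.1 i).ne'
    have hz0 := (hp.2 i).ne'
    have hu0' : (p + (0 : ℝ) • h).1 i ≠ 0 := by simpa using hu0
    have hz0' : (p + (0 : ℝ) • h).2 i ≠ 0 := by simpa using hz0
    have hlog := ((hu p).fun_div (hz p) hz0').log (div_ne_zero hu0' hz0')
    unfold HasLineDerivAt
  · have := (hu p).fun_mul hlog
    simp only [zero_smul, add_zero] at this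
    refine this.congr_deriv ?_
    field_simp
    ring
  · have := ((hlog.const_mul (h.1 i)).add_const (h.1 i)).fun_sub
      (((hu p).mul_const (h.2 i)).fun_div (hz p) hz0')
    simp only [zero_smul, add_zero] at this
    refine this.congr_deriv ?_
    field_simp
  · have := (hu p).fun_mul ((((hasDerivAt_const (0 : ℝ) (h.1 i)).fun_div (hu p) hu0').fun_sub
      ((hasDerivAt_const (0 : ℝ) (h.2 i)).fun_div (hz p) hz0')).fun_pow 2)
    simp only [zero_smul, add_zero] at this
    rw [show 2 - 1 = 1 from rfl, pow_one, Nat.cast_ofNat] at this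
    refine this.congr_deriv ?_
    field_simp
    ring

theorem hasThreeLineDerivsOn_sum_neg_log (h : (Fin ℓ → ℝ) × (Fin ℓ → ℝ)) :
    HasThreeLineDerivsOn (positivePairs ℓ) h
      (fun p => -∑ i, Real.log (p.1 i) - ∑ i, Real.log (p.2 i))
      (fun p => -∑ i, (h.1 i / p.1 i + h.2 i / p.2 i))
      (fun p => ∑ i, ((h.1 i / p.1 i) ^ 2 + (h.2 i / p.2 i) ^ 2))
      (fun p => -(2 * ∑ i, ((h.1 i / p.1 i) ^ 3 + (h.2 i / p.2 i) ^ 3))) := by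
  have hu : ∀ i, HasThreeLineDerivsOn (positivePairs ℓ) h (fun p => -Real.log (p.1 i))
      (fun p => -(h.1 i / p.1 i)) (fun p => (h.1 i / p.1 i) ^ 2 - 0 / p.1 i)
      (fun p => -(0 / p.1 i) + 3 * (0 / p.1 i) * (h.1 i / p.1 i) - 2 * (h.1 i / p.1 i) ^ 3) :=
    fun i => (HasThreeLineDerivsOn.clm ((ContinuousLinearMap.proj i).comp
      (ContinuousLinearMap.fst ℝ (Fin ℓ → ℝ) (Fin ℓ → ℝ)))).neg_log fun p hp => hp.1 i
  have hz : ∀ i, HasThreeLineDerivsOn (positivePairs ℓ) h (fun p => -Real.log (p.2 i))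
      (fun p => -(h.2 i / p.2 i)) (fun p => (h.2 i / p.2 i) ^ 2 - 0 / p.2 i)
      (fun p => -(0 / p.2 i) + 3 * (0 / p.2 i) * (h.2 i / p.2 i) - 2 * (h.2 i / p.2 i) ^ 3) :=
    fun i => (HasThreeLineDerivsOn.clm ((ContinuousLinearMap.proj i).comp
      (ContinuousLinearMap.snd ℝ (Fin ℓ → ℝ) (Fin ℓ → ℝ)))).neg_log fun p hp => hp.2 i
  convert HasThreeLineDerivsOn.sum Finset.univ fun i _ => (hu i).add (hz i) using 2 with p p p p
  · simp only [Finset.sum_add_distrib, Finset.sum_neg_distrib]; ring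
  · rw [← Finset.sum_neg_distrib]
    exact Finset.sum_congr rfl fun i _ => by ring
  · exact Finset.sum_congr rfl fun i _ => by ring
  · rw [Finset.mul_sum, ← Finset.sum_neg_distrib]
    exact Finset.sum_congr rfl fun i _ => by ring

theorem convexOn_entropy : ConvexOn ℝ (positivePairs ℓ)
    (fun p => ∑ i, p.1 i * Real.log (p.1 i / p.2 i)) :=
  convexOn_of_hasLineDerivAt2_nonneg convex_positivePairs
    (fun h => (hasThreeLineDerivsOn_entropy h).first)
    (fun h => (hasThreeLineDerivsOn_entropy h).second)
    fun _ _ hp => Finset.sum_nonneg fun i _ => mul_nonneg (hp.1 i).le (sq_nonneg _)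

/-- Each |aᵢ| and |bᵢ| is at most √R, so one factor of every cube can be pulled out. This is the
self-concordance estimate for the sum of logarithms. -/
theorem abs_sum_cube_add_cube_le {ι : Type*} (s : Finset ι) (a b : ι → ℝ) :
    |∑ i ∈ s, (a i ^ 3 + b i ^ 3)| ≤
      √(∑ i ∈ s, (a i ^ 2 + b i ^ 2)) * ∑ i ∈ s, (a i ^ 2 + b i ^ 2) := by
  rw [Finset.mul_sum]
  refine (Finset.abs_sum_le_sum_abs _ _).trans (Finset.sum_le_sum fun i hi => ?_)
  have hle : a i ^ 2 + b i ^ 2 ≤ ∑ i ∈ s, (a i ^ 2 + b i ^ 2) :=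
    Finset.single_le_sum (f := fun i => a i ^ 2 + b i ^ 2) (fun j _ => by positivity) hi
  have ha : |a i| ≤ √(∑ i ∈ s, (a i ^ 2 + b i ^ 2)) :=
    Real.abs_le_sqrt (by linarith [sq_nonneg (b i)])
  have hb : |b i| ≤ √(∑ i ∈ s, (a i ^ 2 + b i ^ 2)) :=
    Real.abs_le_sqrt (by linarith [sq_nonneg (a i)])
  calc |a i ^ 3 + b i ^ 3| ≤ |a i ^ 3| + |b i ^ 3| := abs_add_le _ _
    _ = |a i| * a i ^ 2 + |b i| * b i ^ 2 := by
      simp only [pow_succ' _ 2, abs_mul, abs_sq]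
    _ ≤ _ := by rw [mul_add]; gcongr

/-- The constant is 3 = 1 + 2, from |aᵢ| + 2|bᵢ| ≤ 3√R. It bounds the third derivative of the
entropy by its second, with the wᵢ as the terms of the latter. -/
theorem abs_sum_weight_mul_le {ι : Type*} (s : Finset ι) (w a b : ι → ℝ) (hw : ∀ i ∈ s, 0 ≤ w i) :
    |∑ i ∈ s, -(w i * (a i + 2 * b i))| ≤
      3 * √(∑ i ∈ s, (a i ^ 2 + b i ^ 2)) * ∑ i ∈ s, w i := by
  rw [Finset.mul_sum]
  refine (Finset.abs_sum_le_sum_abs _ _).trans (Finset.sum_le_sum fun i hi => ?_)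
  have hle : a i ^ 2 + b i ^ 2 ≤ ∑ i ∈ s, (a i ^ 2 + b i ^ 2) :=
    Finset.single_le_sum (f := fun i => a i ^ 2 + b i ^ 2) (fun j _ => by positivity) hi
  have ha : |a i| ≤ √(∑ i ∈ s, (a i ^ 2 + b i ^ 2)) :=
    Real.abs_le_sqrt (by linarith [sq_nonneg (b i)])
  have hb : |b i| ≤ √(∑ i ∈ s, (a i ^ 2 + b i ^ 2)) :=
    Real.abs_le_sqrt (by linarith [sq_nonneg (a i)])
  rw [abs_neg, abs_mul, abs_of_nonneg (hw i hi), mul_comm]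
  refine mul_le_mul_of_nonneg_right ?_ (hw i hi)
  calc |a i + 2 * b i| ≤ |a i| + |2 * b i| := abs_add_le _ _
    _ = |a i| + 2 * |b i| := by rw [abs_mul, abs_two]
    _ ≤ _ := by linarith

theorem sq_sum_add_le {ι : Type*} (s : Finset ι) (a b : ι → ℝ) :
    (∑ i ∈ s, (a i + b i)) ^ 2 ≤ 2 * s.card * ∑ i ∈ s, (a i ^ 2 + b i ^ 2) := by
  calc (∑ i ∈ s, (a i + b i)) ^ 2 ≤ s.card * ∑ i ∈ s, (a i + b i) ^ 2 := sq_sum_le_card_mul_sum_sq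
    _ ≤ s.card * ∑ i ∈ s, 2 * (a i ^ 2 + b i ^ 2) := by
      gcongr; exact add_sq_le
    _ = _ := by rw [← Finset.mul_sum]; ring

theorem rpow_three_halves {x : ℝ} (hx : 0 ≤ x) : x ^ (3 / 2 : ℝ) = √x * x := by
  rw [show (3 / 2 : ℝ) = 1 / 2 + 1 by norm_num, Real.rpow_add_one' hx (by norm_num),
    ← Real.sqrt_eq_rpow]

end PositivePairs

/-! ### The orthant barrier, compatibility, and the closed epigraph -/

section Barriers

variable {ℓ : ℕ}

theorem isClosed_sublevel_sum_neg_log (c : ℝ) : IsClosed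
    {p : (Fin ℓ → ℝ) × (Fin ℓ → ℝ) | p ∈ positivePairs ℓ ∧
      -∑ i, Real.log (p.1 i) - ∑ i, Real.log (p.2 i) ≤ c} := by
  -- After exponentiation the bound is a polynomial inequality with positive left side; on the
  -- closed orthant it excludes vanishing coordinates by itself.
  have h : {p : (Fin ℓ → ℝ) × (Fin ℓ → ℝ) | p ∈ positivePairs ℓ ∧
      -∑ i, Real.log (p.1 i) - ∑ i, Real.log (p.2 i) ≤ c} =
      {p | ((∀ i, 0 ≤ p.1 i) ∧ (∀ i, 0 ≤ p.2 i)) ∧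
        Real.exp (-c) ≤ (∏ i, p.1 i) * ∏ i, p.2 i} := by
    have key : ∀ p ∈ positivePairs ℓ, (-∑ i, Real.log (p.1 i) - ∑ i, Real.log (p.2 i) ≤ c ↔
        Real.exp (-c) ≤ (∏ i, p.1 i) * ∏ i, p.2 i) := by
      rintro p ⟨hu, hz⟩
      have hu' : 0 < ∏ i, p.1 i := Finset.prod_pos fun i _ => hu i
      have hz' : 0 < ∏ i, p.2 i := Finset.prod_pos fun i _ => hz i
      rw [← Real.le_log_iff_exp_le (mul_pos hu' hz'), Real.log_mul hu'.ne' hz'.ne',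
        Real.log_prod fun i _ => (hu i).ne', Real.log_prod fun i _ => (hz i).ne']
      constructor <;> intro h <;> linarith
    ext p
    constructor
    · rintro ⟨hp, hc⟩
      exact ⟨⟨fun i => (hp.1 i).le, fun i => (hp.2 i).le⟩, (key p hp).1 hc⟩
    · rintro ⟨⟨hu, hz⟩, hc⟩
      have hne := (Real.exp_pos (-c)).trans_le hc |>.ne'
      have hp : p ∈ positivePairs ℓ :=
        ⟨fun i => (hu i).lt_of_ne'
          (Finset.prod_ne_zero_iff.1 (left_ne_zero_of_mul hne) i (Finset.mem_univ i)),
        fun i => (hz i).lt_of_ne'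
          (Finset.prod_ne_zero_iff.1 (right_ne_zero_of_mul hne) i (Finset.mem_univ i))⟩
      exact ⟨hp, (key p hp).2 hc⟩
  rw [h]
  exact isClosed_nonnegPairs.inter (isClosed_le continuous_const
    (g := fun p : (Fin ℓ → ℝ) × (Fin ℓ → ℝ) => (∏ i, p.1 i) * ∏ i, p.2 i) (by fun_prop))

theorem isSelfConcordantBarrier_sum_neg_log : IsSelfConcordantBarrier (2 * (ℓ : ℝ))
    {p : (Fin ℓ → ℝ) × (Fin ℓ → ℝ) | (∀ i, 0 ≤ p.1 i) ∧ (∀ i, 0 ≤ p.2 i)}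
    (fun p => -∑ i, Real.log (p.1 i) - ∑ i, Real.log (p.2 i)) where
  parameter_nonneg := by positivity
  isClosed := isClosed_nonnegPairs
  convex := convex_nonnegPairs
  selfConcordant := by
    rw [interior_nonnegPairs]
    exact {
      nonempty := ⟨(fun _ => 1, fun _ => 1), fun _ => one_pos, fun _ => one_pos⟩
      isOpen := isOpen_positivePairs
      convexOn := convexOn_of_hasLineDerivAt2_nonneg convex_positivePairs
        (fun h => (hasThreeLineDerivsOn_sum_neg_log h).first)
        (fun h => (hasThreeLineDerivsOn_sum_neg_log h).second)
        fun _ _ _ => Finset.sum_nonneg fun i _ => by positivity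
      contDiffOn := contDiffOn_sum_neg_log
      third_le := fun p hp h => by
        rw [(hasThreeLineDerivsOn_sum_neg_log h).secondDeriv_eq isOpen_positivePairs
            contDiffOn_sum_neg_log p hp,
          (hasThreeLineDerivsOn_sum_neg_log h).thirdDeriv_eq isOpen_positivePairs
            contDiffOn_sum_neg_log p hp,
          rpow_three_halves (Finset.sum_nonneg fun i _ => by positivity), abs_neg, abs_mul, abs_two]
        gcongr
        exact abs_sum_cube_add_cube_le _ _ _
      isClosed_sublevel := isClosed_sublevel_sum_neg_log }
  decrement_le := fun p hp h => by
    rw [interior_nonnegPairs] at hp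
    rw [(hasThreeLineDerivsOn_sum_neg_log h).secondDeriv_eq isOpen_positivePairs
        contDiffOn_sum_neg_log p hp,
      (hasThreeLineDerivsOn_sum_neg_log h).fderiv_apply_eq isOpen_positivePairs
        contDiffOn_sum_neg_log hp, neg_sq]
    simpa using sq_sum_add_le Finset.univ (fun i => h.1 i / p.1 i) fun i => h.2 i / p.2 i

theorem isCompatible_neg_entropy : IsCompatible (ProperCone.positive ℝ ℝ) 1
    {p : (Fin ℓ → ℝ) × (Fin ℓ → ℝ) | (∀ i, 0 ≤ p.1 i) ∧ (∀ i, 0 ≤ p.2 i)}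
    (fun p => -∑ i, Real.log (p.1 i) - ∑ i, Real.log (p.2 i))
    (fun p => ∑ i, -(p.1 i * Real.log (p.1 i / p.2 i))) := by
  have hA : (fun p : (Fin ℓ → ℝ) × (Fin ℓ → ℝ) => ∑ i, -(p.1 i * Real.log (p.1 i / p.2 i))) =
      fun p => -∑ i, p.1 i * Real.log (p.1 i / p.2 i) :=
    funext fun p => Finset.sum_neg_distrib _
  rw [hA]
  refine ⟨zero_le_one, ⟨_, isSelfConcordantBarrier_sum_neg_log⟩, ?_, ?_, ?_⟩ <;>
    rw [interior_nonnegPairs]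
  · exact contDiffOn_entropy.neg
  · intro p hp q hq a b ha hb hab
    rw [ProperCone.mem_positive]
    have := convexOn_entropy.2 hp hq ha hb hab
    simp only [smul_eq_mul] at this ⊢
    linarith
  · intro p hp h
    have hd := (hasThreeLineDerivsOn_entropy h).neg
    rw [ProperCone.mem_positive, hd.secondDeriv_eq isOpen_positivePairs contDiffOn_entropy.neg p hp,
      hd.thirdDeriv_eq isOpen_positivePairs contDiffOn_entropy.neg p hp,
      (hasThreeLineDerivsOn_sum_neg_log h).secondDeriv_eq isOpen_positivePairs
        contDiffOn_sum_neg_log p hp]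
    -- As A is minus the entropy, both derivatives change sign, and only the lower half of the
    -- two-sided bound is needed.
    have := neg_le_of_abs_le (abs_sum_weight_mul_le Finset.univ
      (fun i => p.1 i * (h.1 i / p.1 i - h.2 i / p.2 i) ^ 2)
      (fun i => h.1 i / p.1 i) (fun i => h.2 i / p.2 i)
      fun i _ => mul_nonneg (hp.1 i).le (sq_nonneg _))
    simp only [smul_eq_mul]
    linarith

/-- The strict epigraph of the vector relative entropy over pairs of positive vectors. -/
def strictEntropyEpigraph (ℓ : ℕ) : Set (ℝ × (Fin ℓ → ℝ) × (Fin ℓ → ℝ)) :=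
  {p | (∀ i, 0 < p.2.1 i) ∧ (∀ i, 0 < p.2.2 i) ∧ vecRelEntropy p.2.1 p.2.2 < p.1}

theorem continuousOn_entropy_snd : ContinuousOn
    (fun p : ℝ × (Fin ℓ → ℝ) × (Fin ℓ → ℝ) => vecRelEntropy p.2.1 p.2.2)
    {p | p.2 ∈ positivePairs ℓ} :=
  contDiffOn_entropy.continuousOn.comp continuous_snd.continuousOn fun _ hp => hp

theorem isOpen_strictEntropyEpigraph : IsOpen (strictEntropyEpigraph ℓ) := by
  have := ((continuousOn_entropy_snd (ℓ := ℓ)).sub continuous_fst.continuousOn).isOpen_inter_preimage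
    (isOpen_positivePairs.preimage continuous_snd) (isOpen_Iio (a := (0 : ℝ)))
  convert this using 1
  ext p
  simp [strictEntropyEpigraph, positivePairs, and_assoc]

theorem closure_vecRelEntropyEpigraph_subset :
    closure (vecRelEntropyEpigraph ℓ) ⊆
      {p | (∀ i, 0 ≤ p.2.1 i) ∧ (∀ i, 0 ≤ p.2.2 i)} :=
  closure_minimal (fun _ hp => ⟨fun i => (hp.1 i).le, fun i => (hp.2.1 i).le⟩)
    (isClosed_nonnegPairs.preimage continuous_snd)

/-- The entropy is continuous at positive pairs, so the closure adds no points above them. -/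
theorem vecRelEntropy_le_of_mem_closure {p : ℝ × (Fin ℓ → ℝ) × (Fin ℓ → ℝ)}
    (hp : p ∈ closure (vecRelEntropyEpigraph ℓ)) (hpos : p.2 ∈ positivePairs ℓ) :
    vecRelEntropy p.2.1 p.2.2 ≤ p.1 := by
  have hc := continuousOn_entropy_snd.continuousAt
    ((isOpen_positivePairs.preimage continuous_snd).mem_nhds hpos)
  rw [mem_closure_iff_clusterPt] at hp
  have : (𝓝[vecRelEntropyEpigraph ℓ] p).NeBot := hp
  exact le_of_tendsto_of_tendsto (hc.tendsto.mono_left nhdsWithin_le_nhds)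
    (continuous_fst.continuousAt.tendsto.mono_left nhdsWithin_le_nhds)
    ((eventually_mem_nhdsWithin (s := vecRelEntropyEpigraph ℓ)).mono fun q hq => hq.2.2)

theorem interior_closure_vecRelEntropyEpigraph :
    interior (closure (vecRelEntropyEpigraph ℓ)) = strictEntropyEpigraph ℓ := by
  refine Set.Subset.antisymm (fun p hp => ?_) (interior_maximal
    (fun p hp => subset_closure ⟨hp.1, hp.2.1, hp.2.2.le⟩) isOpen_strictEntropyEpigraph)
  have hpos : p.2 ∈ positivePairs ℓ := by
    have := interior_mono closure_vecRelEntropyEpigraph_subset hp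
    have h2 := (isOpenMap_snd.preimage_interior_eq_interior_preimage continuous_snd
      {p : (Fin ℓ → ℝ) × (Fin ℓ → ℝ) | (∀ i, 0 ≤ p.1 i) ∧ (∀ i, 0 ≤ p.2 i)} (X := ℝ × _)).symm
    rw [interior_nonnegPairs] at h2
    exact h2.subset this
  refine ⟨hpos.1, hpos.2, ?_⟩
  -- Strictness: an interior point stays in the closure when t is lowered by a small s > 0, whence f
  -- ≤ t - s < t.
  have hcont : Tendsto (fun s : ℝ => (p.1 - s, p.2)) (𝓝[>] 0) (𝓝 p) := by
    have : Continuous fun s : ℝ => (p.1 - s, p.2) := by fun_prop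
    simpa using (this.tendsto 0).mono_left nhdsWithin_le_nhds
  obtain ⟨s, hs, hs0⟩ := ((hcont.eventually (isOpen_interior.mem_nhds hp)).and
    self_mem_nhdsWithin).exists
  have := vecRelEntropy_le_of_mem_closure (interior_subset hs) hpos
  have hs0 : 0 < s := hs0
  linarith

theorem convex_vecRelEntropyEpigraph : Convex ℝ (vecRelEntropyEpigraph ℓ) := by
  intro p hp q hq a b ha hb hab
  have hpos := convex_positivePairs (x := p.2) ⟨hp.1, hp.2.1⟩ (y := q.2) ⟨hq.1, hq.2.1⟩ ha hb hab
  have hc := convexOn_entropy.2 (x := p.2) ⟨hp.1, hp.2.1⟩ (y := q.2) ⟨hq.1, hq.2.1⟩ ha hb hab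
  refine ⟨hpos.1, hpos.2, hc.trans ?_⟩
  exact add_le_add (mul_le_mul_of_nonneg_left hp.2.2 ha) (mul_le_mul_of_nonneg_left hq.2.2 hb)

theorem vecRelEntropy_smul {s : ℝ} (hs : s ≠ 0) (u z : Fin ℓ → ℝ) :
    vecRelEntropy (s • u) (s • z) = s * vecRelEntropy u z := by
  simp only [vecRelEntropy, Finset.mul_sum, Pi.smul_apply, smul_eq_mul, mul_div_mul_left _ _ hs,
    mul_assoc]

theorem smul_mem_closure_vecRelEntropyEpigraph {p : ℝ × (Fin ℓ → ℝ) × (Fin ℓ → ℝ)}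
    (hp : p ∈ closure (vecRelEntropyEpigraph ℓ)) {s : ℝ} (hs : 0 < s) :
    s • p ∈ closure (vecRelEntropyEpigraph ℓ) := by
  refine map_mem_closure (continuous_const_smul s) hp fun q hq => ?_
  refine ⟨fun i => mul_pos hs (hq.1 i), fun i => mul_pos hs (hq.2.1 i), ?_⟩
  change vecRelEntropy (s • q.2.1) (s • q.2.2) ≤ s * q.1
  rw [vecRelEntropy_smul hs.ne']
  exact mul_le_mul_of_nonneg_left hq.2.2 hs.le

/-- From ln x ≥ 1 - 1/x at x = uᵢ/zᵢ. The lower bound is continuous on the whole space, unlike the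
entropy. -/
theorem sum_sub_le_vecRelEntropy {u z : Fin ℓ → ℝ} (hu : ∀ i, 0 < u i) (hz : ∀ i, 0 < z i) :
    ∑ i, (u i - z i) ≤ vecRelEntropy u z := by
  refine Finset.sum_le_sum fun i _ => ?_
  have h := mul_le_mul_of_nonneg_left (Real.one_sub_inv_le_log_of_pos (div_pos (hu i) (hz i)))
    (hu i).le
  have h0 := (hu i).ne'
  calc u i - z i = u i * (1 - (u i / z i)⁻¹) := by field_simp
    _ ≤ _ := h

end Barriers

/-! ### The barrier of the entropy cone -/

section EntropyBarrier

variable {ℓ : ℕ}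

theorem vecRelEntropyBarrier_le_iff {p : ℝ × (Fin ℓ → ℝ) × (Fin ℓ → ℝ)}
    (hp : p ∈ strictEntropyEpigraph ℓ) (c : ℝ) : vecRelEntropyBarrier ℓ p ≤ c ↔
      Real.exp (-c) ≤ (p.1 - vecRelEntropy p.2.1 p.2.2) * ((∏ i, p.2.1 i) * ∏ i, p.2.2 i) := by
  obtain ⟨hu, hz, ht⟩ := hp
  have hu' : 0 < ∏ i, p.2.1 i := Finset.prod_pos fun i _ => hu i
  have hz' : 0 < ∏ i, p.2.2 i := Finset.prod_pos fun i _ => hz i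
  have ht' : 0 < p.1 - vecRelEntropy p.2.1 p.2.2 := sub_pos.2 ht
  rw [← Real.le_log_iff_exp_le (mul_pos ht' (mul_pos hu' hz')),
    Real.log_mul ht'.ne' (mul_pos hu' hz').ne', Real.log_mul hu'.ne' hz'.ne',
    Real.log_prod fun i _ => (hu i).ne', Real.log_prod fun i _ => (hz i).ne',
    vecRelEntropyBarrier, ← vecRelEntropy]
  constructor <;> intro h <;> linarith

theorem isClosed_sublevel_vecRelEntropyBarrier (c : ℝ) :
    IsClosed {p | p ∈ strictEntropyEpigraph ℓ ∧ vecRelEntropyBarrier ℓ p ≤ c} := by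
  -- C replaces the entropy by its continuous minorant, so it is closed and contains the sublevel
  -- set. Its points have positive coordinates, so the true inequality is closed relative to C.
  set C : Set (ℝ × (Fin ℓ → ℝ) × (Fin ℓ → ℝ)) :=
    {p | ((∀ i, 0 ≤ p.2.1 i) ∧ (∀ i, 0 ≤ p.2.2 i)) ∧
      Real.exp (-c) ≤ (p.1 - ∑ i, (p.2.1 i - p.2.2 i)) * ((∏ i, p.2.1 i) * ∏ i, p.2.2 i)} with hC
  have hCclosed : IsClosed C := (isClosed_nonnegPairs.preimage continuous_snd).inter
    (isClosed_le continuous_const (g := fun p : ℝ × (Fin ℓ → ℝ) × (Fin ℓ → ℝ) =>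
      (p.1 - ∑ i, (p.2.1 i - p.2.2 i)) * ((∏ i, p.2.1 i) * ∏ i, p.2.2 i)) (by fun_prop))
  have hCpos : ∀ p ∈ C, p.2 ∈ positivePairs ℓ := by
    rintro p ⟨⟨hu, hz⟩, hc⟩
    have hne := right_ne_zero_of_mul ((Real.exp_pos (-c)).trans_le hc).ne'
    exact ⟨fun i => (hu i).lt_of_ne'
        (Finset.prod_ne_zero_iff.1 (left_ne_zero_of_mul hne) i (Finset.mem_univ i)),
      fun i => (hz i).lt_of_ne'
        (Finset.prod_ne_zero_iff.1 (right_ne_zero_of_mul hne) i (Finset.mem_univ i))⟩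
  have hprod : ∀ p : ℝ × (Fin ℓ → ℝ) × (Fin ℓ → ℝ), p.2 ∈ positivePairs ℓ →
      0 < (∏ i, p.2.1 i) * ∏ i, p.2.2 i := fun p hp =>
    mul_pos (Finset.prod_pos fun i _ => hp.1 i) (Finset.prod_pos fun i _ => hp.2 i)
  have hcont : ContinuousOn (fun p : ℝ × (Fin ℓ → ℝ) × (Fin ℓ → ℝ) =>
      (p.1 - vecRelEntropy p.2.1 p.2.2) * ((∏ i, p.2.1 i) * ∏ i, p.2.2 i)) C :=
    (continuous_fst.continuousOn.sub (continuousOn_entropy_snd.mono hCpos)).mul (by fun_prop)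
  convert hCclosed.isClosed_le (continuousOn_const (c := Real.exp (-c))) hcont using 1
  ext p
  constructor
  · rintro ⟨hp, hc⟩
    have hc' := (vecRelEntropyBarrier_le_iff hp c).1 hc
    refine ⟨⟨⟨fun i => (hp.1 i).le, fun i => (hp.2.1 i).le⟩, hc'.trans ?_⟩, hc'⟩
    refine mul_le_mul_of_nonneg_right ?_ (hprod p ⟨hp.1, hp.2.1⟩).le
    linarith [sum_sub_le_vecRelEntropy hp.1 hp.2.1]
  · rintro ⟨hp, hc⟩
    have hpos := hCpos p hp
    have ht := pos_of_mul_pos_left ((Real.exp_pos (-c)).trans_le hc) (hprod p hpos).le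
    have hmem : p ∈ strictEntropyEpigraph ℓ := ⟨hpos.1, hpos.2, sub_pos.1 ht⟩
    exact ⟨hmem, (vecRelEntropyBarrier_le_iff hmem c).2 hc⟩

theorem vecRelEntropyBarrier_eq : vecRelEntropyBarrier ℓ = fun p =>
    -Real.log (p.1 + -∑ i, p.2.1 i * Real.log (p.2.1 i / p.2.2 i)) +
      (-∑ i, Real.log (p.2.1 i) - ∑ i, Real.log (p.2.2 i)) := by
  funext p
  rw [vecRelEntropyBarrier, sub_eq_add_neg p.1]
  ring

theorem slack_pos_of_mem {p : ℝ × (Fin ℓ → ℝ) × (Fin ℓ → ℝ)} (hp : p ∈ strictEntropyEpigraph ℓ) :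
    0 < p.1 + -∑ i, p.2.1 i * Real.log (p.2.1 i / p.2.2 i) := by
  have : ∑ i, p.2.1 i * Real.log (p.2.1 i / p.2.2 i) < p.1 := hp.2.2
  linarith

theorem mapsTo_snd_strictEntropyEpigraph :
    Set.MapsTo Prod.snd (strictEntropyEpigraph ℓ) (positivePairs ℓ) :=
  fun _ hp => ⟨hp.1, hp.2.1⟩

theorem contDiffOn_vecRelEntropyBarrier :
    ContDiffOn ℝ 3 (vecRelEntropyBarrier ℓ) (strictEntropyEpigraph ℓ) := by
  rw [vecRelEntropyBarrier_eq]
  refine ContDiffOn.add (ContDiffOn.neg (ContDiffOn.log (ContDiffOn.add (by fun_prop)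
    (ContDiffOn.neg ?_)) fun p hp => (slack_pos_of_mem hp).ne')) ?_
  · exact contDiffOn_entropy.comp contDiff_snd.contDiffOn mapsTo_snd_strictEntropyEpigraph
  · exact contDiffOn_sum_neg_log.comp contDiff_snd.contDiffOn mapsTo_snd_strictEntropyEpigraph

/-- The line derivatives of the entropy barrier, in terms of `d = τ' / τ`, `σ = -τ'' / τ` and
`κ = τ''' / τ` for the slack `τ = t - ∑ uᵢ ln (uᵢ/zᵢ)`. -/
theorem exists_hasThreeLineDerivsOn_vecRelEntropyBarrier (h : ℝ × (Fin ℓ → ℝ) × (Fin ℓ → ℝ)) :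
    ∃ d σ κ : ℝ × (Fin ℓ → ℝ) × (Fin ℓ → ℝ) → ℝ,
      (∀ p ∈ strictEntropyEpigraph ℓ, 0 ≤ σ p ∧
        |κ p| ≤ 3 * √(∑ i, ((h.2.1 i / p.2.1 i) ^ 2 + (h.2.2 i / p.2.2 i) ^ 2)) * σ p) ∧
      HasThreeLineDerivsOn (strictEntropyEpigraph ℓ) h (vecRelEntropyBarrier ℓ)
        (fun p => -d p + -∑ i, (h.2.1 i / p.2.1 i + h.2.2 i / p.2.2 i))
        (fun p => d p ^ 2 + σ p + ∑ i, ((h.2.1 i / p.2.1 i) ^ 2 + (h.2.2 i / p.2.2 i) ^ 2))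
        (fun p => -κ p - 3 * σ p * d p - 2 * d p ^ 3 +
          -(2 * ∑ i, ((h.2.1 i / p.2.1 i) ^ 3 + (h.2.2 i / p.2.2 i) ^ 3))) := by
  set L := ContinuousLinearMap.snd ℝ ℝ ((Fin ℓ → ℝ) × (Fin ℓ → ℝ))
  have hs : Set.MapsTo L (strictEntropyEpigraph ℓ) (positivePairs ℓ) :=
    mapsTo_snd_strictEntropyEpigraph
  have hτ := (((HasThreeLineDerivsOn.clm (Q := strictEntropyEpigraph ℓ) (h := h)
    (ContinuousLinearMap.fst ℝ ℝ ((Fin ℓ → ℝ) × (Fin ℓ → ℝ)))).add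
      ((hasThreeLineDerivsOn_entropy (L h)).comp_clm L hs).neg).neg_log
        fun p hp => slack_pos_of_mem hp).add ((hasThreeLineDerivsOn_sum_neg_log (L h)).comp_clm L hs)
  set τ : ℝ × (Fin ℓ → ℝ) × (Fin ℓ → ℝ) → ℝ :=
    fun p => p.1 + -∑ i, p.2.1 i * Real.log (p.2.1 i / p.2.2 i) with hτdef
  refine ⟨fun p => (h.1 + -∑ i, (h.2.1 i * Real.log (p.2.1 i / p.2.2 i) + h.2.1 i -
      p.2.1 i * h.2.2 i / p.2.2 i)) / τ p,
    fun p => (∑ i, p.2.1 i * (h.2.1 i / p.2.1 i - h.2.2 i / p.2.2 i) ^ 2) / τ p,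
    fun p => (-∑ i, -(p.2.1 i * (h.2.1 i / p.2.1 i - h.2.2 i / p.2.2 i) ^ 2 *
        (h.2.1 i / p.2.1 i + 2 * (h.2.2 i / p.2.2 i)))) / τ p, fun p hp => ⟨?_, ?_⟩, ?_⟩
  · exact div_nonneg (Finset.sum_nonneg fun i _ => mul_nonneg (hp.1 i).le (sq_nonneg _))
      (slack_pos_of_mem hp).le
  · have hpos : 0 < τ p := slack_pos_of_mem hp
    rw [abs_div, abs_of_pos hpos, abs_neg, ← mul_div_assoc]
    gcongr
    exact abs_sum_weight_mul_le Finset.univ _ (fun i => h.2.1 i / p.2.1 i)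
      (fun i => h.2.2 i / p.2.2 i) fun i _ => mul_nonneg (hp.1 i).le (sq_nonneg _)
  · rw [vecRelEntropyBarrier_eq]
    convert hτ using 2 with p p p p <;>
      simp only [hτdef, L, ContinuousLinearMap.coe_fst', ContinuousLinearMap.coe_snd'] <;> ring

/-- The difference of the two sides is (M - w)²(2M + w). -/
theorem mul_three_mul_sq_sub_sq_le {w M : ℝ} (hw : 0 ≤ w) (hM : 0 ≤ M) :
    w * (3 * M ^ 2 - w ^ 2) ≤ 2 * M ^ 3 := by
  nlinarith [mul_nonneg (sq_nonneg (M - w)) (by positivity : 0 ≤ 2 * M + w)]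

theorem abs_third_le_of_abs_le {d σ κ R T : ℝ} (hσ : 0 ≤ σ) (hR : 0 ≤ R) (hκ : |κ| ≤ 3 * √R * σ)
    (hT : |T| ≤ √R * R) :
    |-κ - 3 * σ * d - 2 * d ^ 3 + -(2 * T)| ≤ 2 * (d ^ 2 + σ + R) ^ (3 / 2 : ℝ) := by
  have hM : 0 ≤ d ^ 2 + σ + R := by positivity
  have h1 := mul_three_mul_sq_sub_sq_le (add_nonneg (abs_nonneg d) (Real.sqrt_nonneg R))
    (Real.sqrt_nonneg (d ^ 2 + σ + R))
  rw [Real.sq_sqrt hM, pow_succ' _ 2, Real.sq_sqrt hM] at h1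
  rw [rpow_three_halves hM]
  refine le_trans ?_ h1
  have hr := Real.sq_sqrt hR
  calc |-κ - 3 * σ * d - 2 * d ^ 3 + -(2 * T)|
      ≤ |κ| + 3 * σ * |d| + 2 * |d| ^ 3 + 2 * |T| := by
        have e1 : |3 * σ * d| = 3 * σ * |d| := by
          rw [abs_mul, abs_of_nonneg (by positivity : 0 ≤ 3 * σ)]
        have e2 : |2 * d ^ 3| = 2 * |d| ^ 3 := by rw [abs_mul, abs_two, abs_pow]
        rw [← e1, ← e2, abs_le]
        have := abs_le.1 (le_refl |κ|)
        have := abs_le.1 (le_refl |3 * σ * d|)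
        have := abs_le.1 (le_refl |2 * d ^ 3|)
        have := abs_le.1 (le_refl |T|)
        constructor <;> linarith
    _ ≤ 3 * √R * σ + 3 * σ * |d| + 2 * |d| ^ 3 + 2 * (√R * R) := by gcongr
    -- With r = √R, the identity |d|³ + r³ = (|d| + r)(d² - |d|r + r²) produces the form w(3M² -
    -- w²).
    _ = (|d| + √R) * (3 * (|d| ^ 2 + σ + √R ^ 2) - (|d| + √R) ^ 2) := by
        rw [← hr]; simp only [Real.sqrt_sq (Real.sqrt_nonneg R)]; ring
    _ = _ := by rw [sq_abs, hr]

theorem isSelfConcordantOn_vecRelEntropyBarrier :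
    IsSelfConcordantOn (strictEntropyEpigraph ℓ) (vecRelEntropyBarrier ℓ) where
  nonempty := ⟨(1, fun _ => 1, fun _ => 1), fun _ => one_pos, fun _ => one_pos, by
    simp [vecRelEntropy]⟩
  isOpen := isOpen_strictEntropyEpigraph
  convexOn := by
    choose d σ κ hb hd using exists_hasThreeLineDerivsOn_vecRelEntropyBarrier (ℓ := ℓ)
    refine convexOn_of_hasLineDerivAt2_nonneg ?_ (fun h => (hd h).first) (fun h => (hd h).second)
      fun h p hp => ?_
    · rw [← interior_closure_vecRelEntropyEpigraph]
      exact convex_vecRelEntropyEpigraph.closure.interior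
    · have := (hb h p hp).1
      have : 0 ≤ ∑ i, ((h.2.1 i / p.2.1 i) ^ 2 + (h.2.2 i / p.2.2 i) ^ 2) :=
        Finset.sum_nonneg fun i _ => by positivity
      positivity
  contDiffOn := contDiffOn_vecRelEntropyBarrier
  third_le p hp h := by
    obtain ⟨d, σ, κ, hb, hd⟩ := exists_hasThreeLineDerivsOn_vecRelEntropyBarrier h
    rw [hd.secondDeriv_eq isOpen_strictEntropyEpigraph contDiffOn_vecRelEntropyBarrier p hp,
      hd.thirdDeriv_eq isOpen_strictEntropyEpigraph contDiffOn_vecRelEntropyBarrier p hp]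
    exact abs_third_le_of_abs_le (hb p hp).1 (Finset.sum_nonneg fun i _ => by positivity) (hb p hp).2
      (abs_sum_cube_add_cube_le _ _ _)
  isClosed_sublevel := isClosed_sublevel_vecRelEntropyBarrier

/-- Adding one logarithm raises the parameter n by one. The cross term is handled by (2ab)² ≤ 4na²R
≤ (na² + R)², which avoids dividing by n and so covers n = 0. -/
theorem add_sq_le_mul_of_sq_le {a b n R σ : ℝ} (hn : 0 ≤ n) (hR : 0 ≤ R) (hσ : 0 ≤ σ)
    (hb : b ^ 2 ≤ n * R) : (-a + -b) ^ 2 ≤ (n + 1) * (a ^ 2 + σ + R) := by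
  have hab : 2 * a * b ≤ n * a ^ 2 + R := by
    refine le_of_abs_le (abs_le_of_sq_le_sq ?_ (by positivity))
    nlinarith [sq_nonneg (n * a ^ 2 - R), mul_le_mul_of_nonneg_left hb (sq_nonneg a)]
  nlinarith [mul_nonneg hn hσ]

/-- The slack is homogeneous of degree one, so each of the 2ℓ + 1 logarithms contributes one ln s.
-/
theorem vecRelEntropyBarrier_smul {p : ℝ × (Fin ℓ → ℝ) × (Fin ℓ → ℝ)}
    (hp : p ∈ strictEntropyEpigraph ℓ) {s : ℝ} (hs : 0 < s) :
    vecRelEntropyBarrier ℓ (s • p) = vecRelEntropyBarrier ℓ p - (2 * (ℓ : ℝ) + 1) * Real.log s := by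
  obtain ⟨hu, hz, ht⟩ := hp
  have e : (s • p).1 - vecRelEntropy (s • p).2.1 (s • p).2.2 =
      s * (p.1 - vecRelEntropy p.2.1 p.2.2) := by
    have := vecRelEntropy_smul hs.ne' p.2.1 p.2.2
    simp only [Prod.smul_fst, Prod.smul_snd, smul_eq_mul, this, mul_sub]
  unfold vecRelEntropy at e ht
  unfold vecRelEntropyBarrier
  rw [e, Real.log_mul hs.ne' (sub_pos.2 ht).ne']
  simp only [Prod.smul_fst, Prod.smul_snd, Pi.smul_apply, smul_eq_mul,
    fun i => Real.log_mul hs.ne' (hu i).ne', fun i => Real.log_mul hs.ne' (hz i).ne',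
    Finset.sum_add_distrib, Finset.sum_const, Finset.card_univ, Fintype.card_fin, nsmul_eq_mul]
  ring

theorem isLHSelfConcordantBarrier_vecRelEntropyBarrier :
    IsLHSelfConcordantBarrier (2 * (ℓ : ℝ) + 1) (closure (vecRelEntropyEpigraph ℓ))
      (vecRelEntropyBarrier ℓ) where
  cone _ hp _ hs := smul_mem_closure_vecRelEntropyEpigraph hp hs
  barrier :=
    { parameter_nonneg := by positivity
      isClosed := isClosed_closure
      convex := convex_vecRelEntropyEpigraph.closure
      selfConcordant := by
        rw [interior_closure_vecRelEntropyEpigraph]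
        exact isSelfConcordantOn_vecRelEntropyBarrier
      decrement_le := fun p hp h => by
        rw [interior_closure_vecRelEntropyEpigraph] at hp
        obtain ⟨d, σ, κ, hb, hd⟩ := exists_hasThreeLineDerivsOn_vecRelEntropyBarrier h
        rw [hd.secondDeriv_eq isOpen_strictEntropyEpigraph contDiffOn_vecRelEntropyBarrier p hp,
          hd.fderiv_apply_eq isOpen_strictEntropyEpigraph contDiffOn_vecRelEntropyBarrier hp]
        refine add_sq_le_mul_of_sq_le (by positivity)
          (Finset.sum_nonneg fun i _ => by positivity) (hb p hp).1 ?_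
        simpa using sq_sum_add_le Finset.univ (fun i => h.2.1 i / p.2.1 i)
          fun i => h.2.2 i / p.2.2 i }
  logHomogeneous _ hp _ hs := by
    rw [interior_closure_vecRelEntropyEpigraph] at hp
    exact vecRelEntropyBarrier_smul hp hs

end EntropyBarrier

theorem mainTheorem1 (ℓ : ℕ) :
    interior (closure (vecRelEntropyEpigraph ℓ)) =
        {p | (∀ i, 0 < p.2.1 i) ∧ (∀ i, 0 < p.2.2 i) ∧ vecRelEntropy p.2.1 p.2.2 < p.1} ∧
      IsLHSelfConcordantBarrier (2 * (ℓ : ℝ) + 1) (closure (vecRelEntropyEpigraph ℓ))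
        (vecRelEntropyBarrier ℓ) ∧
      IsCompatible (ProperCone.positive ℝ ℝ) 1
        {p : (Fin ℓ → ℝ) × (Fin ℓ → ℝ) | (∀ i, 0 ≤ p.1 i) ∧ (∀ i, 0 ≤ p.2 i)}
        (fun p => -∑ i, Real.log (p.1 i) - ∑ i, Real.log (p.2 i))
        (fun p => ∑ i, -(p.1 i * Real.log (p.1 i / p.2 i))) :=
  ⟨interior_closure_vecRelEntropyEpigraph, isLHSelfConcordantBarrier_vecRelEntropyBarrier,
    isCompatible_neg_entropy⟩
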